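/- **SRT-MIC model.** There are $n$ users, $m$ identical cores and periods $t=1,2,\dots$ of length $\delta>0$. In each period every user $i$ generates one task, available at the beginning of the period and dropped if it is not completed by its end. The workloads are independent over users and periods, and those of user $i$ have the law of a non-negative random variable $W_i$ with finite mean $\mu_i$. At every time a core processes at most one task and a task is processed by at most one core; preemption and migration are allowed and free; a task is completed when the core time it has received in its period reaches its workload. A resource allocation policy is non-clairvoyant if its decision at each time depends only on randomization independent of the workloads and on the task completions observed so far, in earlier periods and in the current one (the workload distributions may be known). For a vector $q\in\mathbb R^n_+$ define the deficits $X_i(t+1)=\max\{X_i(t)+q_i-Y_i(t+1),\,0\}$, where $Y_i(t+1)\in\{0,1\}$ indicates that user $i$'s task of period $t+1$ is completed. A policy fulfills $q$ if, for some initial state $X(0)$, the process $\{X(t)\}_{t\ge1}$ is an irreducible, positive recurrent (time-homogeneous) Markov chain on a countable state space. The feasibility region $F$ is the set of all $q\in\mathbb R^n_+$ that are fulfilled by some non-clairvoyant policy. **Theorem.** Suppose that every $W_i$ is New Better than Used in Expectation, i.e. $\mathbb E[W_i-t\mid W_i>t]\le\mathbb E[W_i]$ for all $t>0$ with $\Pr(W_i>t)>0$.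 Then $$F\subseteq R_{\mathrm{OB}}=\Big\{q\in\mathbb R^n_+ : q_i\le 1 \text{ for all } i,\ \sum_{i=1}^n q_i\mu_i\le m\delta\Big\}.$$ -/

import Mathlib

open MeasureTheory ProbabilityTheory Set
open scoped ENNReal

namespace SRT

noncomputable section

/-! ### Workload distributions -/

/-- `ν` is the law of a non-negative random variable `W` with finite mean that is New Better than
Used in Expectation: `E[W - t | W > t] ≤ E[W]` for all `t > 0`.  (If `P(W > t) = 0` the
conditional measure `ν[|Ioi t]` is the zero measure and the inequality imposes nothing.) -/
structure IsNBUE (ν : Measure ℝ) : Prop where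
  nonneg : ∀ᵐ x ∂ν, 0 ≤ x
  integrable : Integrable (fun x : ℝ => x) ν
  residual_le : ∀ t : ℝ, 0 < t → ∫ x, (x - t) ∂(ν[|Ioi t]) ≤ ∫ x, x ∂ν

/-- The workloads of all tasks: `w t i` is the workload of user `i`'s task in the period number `t`
(`t = 0` is the first period). -/
abbrev Workloads (n : ℕ) : Type := ℕ → Fin n → ℝ

/-- The joint law of all workloads: independent over periods and users, the tasks of user `i`
having law `ν i`. -/
def workloadLaw {n : ℕ} (ν : Fin n → Measure ℝ) [∀ i, IsProbabilityMeasure (ν i)] :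
    Measure (Workloads n) :=
  Measure.infinitePi fun _ : ℕ => Measure.pi ν

/-! ### Schedules and policies -/

/-- The schedule of one period: at the time `u` after the beginning of the period, the core `c`
processes the task of user `i` if the value is `some i`, and idles if it is `none`. -/
abbrev Schedule (n m : ℕ) : Type := ℝ → Fin m → Option (Fin n)

/-- The total time during `[0, u)` for which some core is assigned to user `i`. -/
def coreTime {n m : ℕ} (a : Schedule n m) (i : Fin n) (u : ℝ) : ℝ :=
  volume.real {r : ℝ | 0 ≤ r ∧ r < u ∧ ∃ c, a r c = some i}

/-- A task of workload `x` of user `i` is completed by time `u` of the period.  (If a core remains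
assigned to a completed task, it just idles.) -/
def CompletedBy {n m : ℕ} (a : Schedule n m) (i : Fin n) (x u : ℝ) : Prop :=
  x ≤ coreTime a i u

/-- A non-clairvoyant resource allocation policy for `n` users, `m` identical cores and periods
of length `δ`.  The policy may randomize, through a seed `ξ` of law `seedLaw` that is independent
of all workloads (see `Policy.law`), and it may use everything that was observed so far, i.e. which
tasks were completed when, in the earlier periods and in the current period (hence also all
schedules and deficits so far), as well as the workload distributions.  Preemption and
migration are allowed. -/
structure Policy (n m : ℕ) (δ : ℝ) where
  /-- The values of the random seed. -/
  Seed : Type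
  [measurableSpaceSeed : MeasurableSpace Seed]
  /-- The law of the random seed. -/
  seedLaw : Measure Seed
  [isProbabilityMeasure_seedLaw : IsProbabilityMeasure seedLaw]
  /-- `schedule ξ w t` is the schedule of period `t`, if the seed is `ξ` and the workloads
  are `w`. -/
  schedule : Seed → Workloads n → ℕ → Schedule n m
  measurable_schedule : ∀ (t : ℕ) (c : Fin m) (o : Option (Fin n)),
    MeasurableSet {z : Seed × Workloads n × ℝ | schedule z.1 z.2.1 t z.2.2 c = o}
  /-- A task is not processed in parallel. -/
  not_parallel : ∀ ξ w t u c c' i,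
    schedule ξ w t u c = some i → schedule ξ w t u c' = some i → c = c'
  /-- Non-clairvoyance: two workload realizations for which the same completions have been
  observed up to the time `u` of period `t` lead to the same decision at that time. -/
  nonclairvoyant : ∀ (ξ : Seed) (w w' : Workloads n) (t : ℕ) (u : ℝ), 0 ≤ u → u ≤ δ →
    (∀ (s : ℕ) (r : ℝ) (j : Fin n), 0 ≤ r → (s < t ∧ r ≤ δ ∨ s = t ∧ r ≤ u) →
      (CompletedBy (schedule ξ w s) j (w s j) r ↔
        CompletedBy (schedule ξ w' s) j (w' s j) r)) →
    schedule ξ w t u = schedule ξ w' t u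

namespace Policy

variable {n m : ℕ} {δ : ℝ}

attribute [instance] measurableSpaceSeed isProbabilityMeasure_seedLaw

/-- The sample space: the seed of the policy together with the workloads of all tasks. -/
abbrev Sample (η : Policy n m δ) : Type := η.Seed × Workloads n

/-- The probability measure of the system under the policy. -/
def law (η : Policy n m δ) (ν : Fin n → Measure ℝ) [∀ i, IsProbabilityMeasure (ν i)] :
    Measure η.Sample :=
  η.seedLaw.prod (workloadLaw ν)

open Classical in
/-- The indicator that user `i`'s task of period `t` completes by the end of that period. -/
def completion (η : Policy n m δ) (t : ℕ) (i : Fin n) (ω : η.Sample) : ℝ :=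
  if CompletedBy (η.schedule ω.1 ω.2 t) i (ω.2 t i) δ then 1 else 0

/-- The deficit vector `X(t)` after `t` periods, for the requirement vector `q` and the initial
state `X₀`: `X_i(t+1) = [X_i(t) + q_i - Y_i(t+1)]⁺`. -/
def deficit (η : Policy n m δ) (q : Fin n → ℝ) (X₀ : η.Seed → Fin n → ℝ) :
    ℕ → η.Sample → Fin n → ℝ
  | 0, ω => X₀ ω.1
  | t + 1, ω => fun i => max (deficit η q X₀ t ω i + q i - η.completion t i ω) 0

end Policy

/-! ### Markov chains on a countable state space -/

/-- The process `Z` is a time-homogeneous Markov chain, under the probability `P`, with state space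
`S` (to be used for countable `S`) and transition probabilities `p`. -/
structure IsMarkovChain {Ω E : Type*} [MeasurableSpace Ω] (P : Measure Ω) (Z : ℕ → Ω → E)
    (S : Set E) (p : S → PMF S) : Prop where
  mem : ∀ k, ∀ᵐ ω ∂P, Z k ω ∈ S
  markov : ∀ (k : ℕ) (s : ℕ → S),
    P {ω | ∀ j ≤ k + 1, Z j ω = s j} = P {ω | ∀ j ≤ k, Z j ω = s j} * p (s k) (s (k + 1))

/-- The distribution after `k` steps, started in `x`. -/
def nStep {S : Type*} (p : S → PMF S) : ℕ → S → PMF S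
  | 0, x => PMF.pure x
  | k + 1, x => (p x).bind (nStep p k)

/-- Every state can be reached from every state. -/
def Irreducible {S : Type*} (p : S → PMF S) : Prop :=
  ∀ x y, ∃ k, nStep p k x y ≠ 0

open Classical in
/-- The probability that the chain started in `x` visits `y` at the time `k + 1` for the first time
(visits at the time `0` are not counted). -/
def firstPassage {S : Type*} (p : S → PMF S) (y : S) : ℕ → S → ℝ≥0∞
  | 0, x => p x y
  | k + 1, x => ∑' z, if z = y then 0 else p x z * firstPassage p y k z

/-- Every state is positive recurrent: the chain returns to it with probability one, and the
mean return time is finite. -/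
def PositiveRecurrent {S : Type*} (p : S → PMF S) : Prop :=
  ∀ x, ∑' k, firstPassage p x k x = 1 ∧ ∑' k : ℕ, ((k : ℝ≥0∞) + 1) * firstPassage p x k x < ∞

/-! ### The feasibility region and the outer bound -/

/-- The policy `η` fulfills the requirement vector `q`: for some initial state, the deficits
`X(1), X(2), …` form an irreducible and positive recurrent Markov chain on a countable state
space. The initial state `X(0)` may be random, as a function of the seed. -/
def Policy.Fulfills {n m : ℕ} {δ : ℝ} (η : Policy n m δ) (ν : Fin n → Measure ℝ)
    [∀ i, IsProbabilityMeasure (ν i)] (q : Fin n → ℝ) : Prop :=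
  ∃ (X₀ : η.Seed → Fin n → ℝ) (S : Set (Fin n → ℝ)) (p : S → PMF S),
    Measurable X₀ ∧ S.Countable ∧
    IsMarkovChain (η.law ν) (fun t => η.deficit q X₀ (t + 1)) S p ∧
    Irreducible p ∧ PositiveRecurrent p

/-- The system feasibility region `F`: the requirement vectors that are fulfilled by some
non-clairvoyant policy. -/
def feasibilityRegion {n : ℕ} (m : ℕ) (δ : ℝ) (ν : Fin n → Measure ℝ)
    [∀ i, IsProbabilityMeasure (ν i)] : Set (Fin n → ℝ) :=
  {q | (∀ i, 0 ≤ q i) ∧ ∃ η : Policy n m δ, η.Fulfills ν q}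

/-- The outer bound `R_OB`. -/
def outerBound {n : ℕ} (m : ℕ) (δ : ℝ) (ν : Fin n → Measure ℝ) : Set (Fin n → ℝ) :=
  {q | (∀ i, 0 ≤ q i) ∧ (∀ i, q i ≤ 1) ∧ ∑ i, q i * ∫ x, x ∂(ν i) ≤ m * δ}

end

end SRT

/-! Two estimates meet. Long run: the deficit recursion gives `T * q i` minus the completions in `T`
periods `≤` the deficit. Between visits to its initial state a deficit grows by at most `q i` per
period, and the time since the last such visit has tails bounded uniformly in `T` by the tails of a
series whose sum is the mean return time (`IsMarkovChain.age_le`). Hence the deficit is `o(T)` in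
probability (`tendsto_measure_deficit`), and the time averages of the completion probabilities are
asymptotically at least `q i - ε`. As probabilities are at most one, `q i ≤ 1`.

One period: freeze the seed and all workloads except that of one task. By non-clairvoyance the
policy cannot see this workload `x` before completion, so it offers the task an amount `A` of core
time not depending on `x`; the task completes iff `x ≤ A` and gets at least `min x A`
(`coreTime_update`). NBUE says exactly that `μ P(W ≤ A) ≤ E[min(W, A)]`. So mean workload times
completion probability is at most expected core time, and the core times sum to at most `m * δ`.
Averaging over periods and letting `ε → 0` gives the capacity constraint. -/

namespace SRT

noncomputable section

open Classical in
/-- The probability that the chain started in `x` does not visit `y` at the times `1, …, l`. -/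
def avoidProb {S : Type*} (p : S → PMF S) (y : S) : ℕ → S → ℝ≥0∞
  | 0, _ => 1
  | l + 1, x => ∑' z, if z = y then 0 else p x z * avoidProb p y l z

theorem sum_firstPassage_add_avoidProb {S : Type*} (p : S → PMF S) (y : S) (l : ℕ) (x : S) :
    ∑ k ∈ Finset.range l, firstPassage p y k x + avoidProb p y l x = 1 := by
  classical
  induction l generalizing x with
  | zero => simp [avoidProb]
  | succ l ih =>
    rw [Finset.sum_range_succ']
    simp only [firstPassage, avoidProb]
    rw [← Summable.tsum_finsetSum (fun _ _ => ENNReal.summable), add_right_comm,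
      ← ENNReal.tsum_add]
    have h : ∀ z, (∑ k ∈ Finset.range l, (if z = y then 0 else p x z * firstPassage p y k z)) +
        (if z = y then 0 else p x z * avoidProb p y l z) = if z = y then 0 else p x z := by
      intro z
      split_ifs with hz
      · simp
      · rw [← Finset.mul_sum, ← mul_add, ih, mul_one]
    simp_rw [h]
    rw [← (p x).tsum_coe, ENNReal.tsum_eq_add_tsum_ite (f := p x) y, add_comm]

theorem avoidProb_eq_tsum {S : Type*} (p : S → PMF S) (y x : S)
    (h : ∑' k, firstPassage p y k x = 1) (l : ℕ) :
    avoidProb p y l x = ∑' k, if l ≤ k then firstPassage p y k x else 0 := by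
  have h1 : ∑ k ∈ Finset.range l, firstPassage p y k x +
      ∑' k, (if l ≤ k then firstPassage p y k x else 0) = 1 := by
    rw [← h]
    have : ∑ k ∈ Finset.range l, firstPassage p y k x =
        ∑' k, if l ≤ k then 0 else firstPassage p y k x := by
      rw [tsum_eq_sum (s := Finset.range l)]
      · refine Finset.sum_congr rfl fun k hk => ?_
        rw [if_neg (by simpa using hk)]
      · intro k hk
        rw [if_pos (by simpa using hk)]
    rw [this, ← ENNReal.tsum_add]
    refine tsum_congr fun k => ?_
    split_ifs <;> simp
  have hfin : ∑ k ∈ Finset.range l, firstPassage p y k x ≠ ∞ := by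
    intro hh
    rw [hh, top_add] at h1
    exact ENNReal.top_ne_one h1
  have h2 := sum_firstPassage_add_avoidProb p y l x
  exact (ENNReal.add_right_inj hfin).1 (h2.trans h1.symm)

/-- The tail-sum formula for the mean passage time. Positive recurrence thereby makes the avoidance
probabilities summable. -/
theorem tsum_avoidProb {S : Type*} (p : S → PMF S) (y x : S)
    (h : ∑' k, firstPassage p y k x = 1) :
    ∑' l, avoidProb p y l x = ∑' k : ℕ, ((k : ℝ≥0∞) + 1) * firstPassage p y k x := by
  simp_rw [avoidProb_eq_tsum p y x h]
  rw [ENNReal.tsum_comm]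
  refine tsum_congr fun k => ?_
  rw [tsum_eq_sum (s := Finset.range (k + 1))]
  · rw [Finset.sum_congr rfl (g := fun _ => firstPassage p y k x)]
    · simp
    · intro l hl
      rw [if_pos (by simpa [Nat.lt_succ_iff] using hl)]
  · intro l hl
    rw [if_neg (by simpa [Nat.lt_succ_iff] using hl)]

section chain

variable {Ω E : Type*} [MeasurableSpace Ω] {P : Measure Ω} {Z : ℕ → Ω → E} {S : Set E}
  {p : S → PMF S}

/-- Induction on `l`: the next state, which is not `y`, is appended to the history. An upper bound
is enough later, so the union bound over this state suffices. -/
theorem IsMarkovChain.history_avoid_le (hS : S.Countable) (hZ : IsMarkovChain P Z S p) (y : S)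
    (l k : ℕ) (s : ℕ → S) :
    P {ω | (∀ j ≤ k, Z j ω = s j) ∧ ∀ j, k < j → j ≤ k + l → Z j ω ≠ y} ≤
      P {ω | ∀ j ≤ k, Z j ω = s j} * avoidProb p y l (s k) := by
  classical
  have : Countable S := hS.to_subtype
  induction l generalizing k s with
  | zero =>
    simp only [avoidProb, mul_one]
    exact measure_mono fun ω hω => hω.1
  | succ l ih =>
    have hsub : {ω | (∀ j ≤ k, Z j ω = s j) ∧ ∀ j, k < j → j ≤ k + (l + 1) → Z j ω ≠ y} ≤ᵐ[P]
        ⋃ z : S, {ω | z ≠ y ∧ (∀ j ≤ k + 1, Z j ω = Function.update s (k + 1) z j) ∧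
          ∀ j, k + 1 < j → j ≤ k + 1 + l → Z j ω ≠ y} := by
      filter_upwards [hZ.mem (k + 1)] with ω hω h
      obtain ⟨h1, h2⟩ := h
      refine mem_iUnion.2 ⟨⟨Z (k + 1) ω, hω⟩, ?_, ?_, ?_⟩
      · intro hh
        exact h2 (k + 1) (by omega) (by omega) (congrArg Subtype.val hh)
      · intro j hj
        rcases hj.lt_or_eq with h | rfl
        · rw [Function.update_of_ne (by omega)]
          exact h1 j (by omega)
        · simp
      · intro j hj hj'
        exact h2 j (by omega) (by omega)
    refine (measure_mono_ae hsub).trans ((measure_iUnion_le _).trans ?_)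
    rw [avoidProb, ← ENNReal.tsum_mul_left]
    refine ENNReal.tsum_le_tsum fun z => ?_
    split_ifs with hz
    · simp [hz]
    · refine (measure_mono fun ω hω => hω.2).trans ((ih (k + 1) _).trans ?_)
      rw [hZ.markov, Function.update_self, Function.update_of_ne (by omega), mul_assoc]
      gcongr P ?_ * _
      intro ω h j hj
      rw [h j (by omega), Function.update_of_ne (by omega)]

/-- Sum of the previous bound over all histories ending in `x`; these are disjoint events, of total
mass at most one. -/
theorem IsMarkovChain.avoid_le [IsProbabilityMeasure P] (hS : S.Countable)
    (hZ : IsMarkovChain P Z S p) (hm : ∀ k (v : E), MeasurableSet {ω | Z k ω = v}) (x y : S)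
    (l k : ℕ) :
    P {ω | Z k ω = x ∧ ∀ j, k < j → j ≤ k + l → Z j ω ≠ y} ≤ avoidProb p y l x := by
  classical
  have : Countable S := hS.to_subtype
  let s : (Fin k → S) → ℕ → S := fun h j => if hj : j < k then h ⟨j, hj⟩ else x
  have hsub : {ω | Z k ω = x ∧ ∀ j, k < j → j ≤ k + l → Z j ω ≠ y} ≤ᵐ[P]
      ⋃ h : Fin k → S, {ω | (∀ j ≤ k, Z j ω = s h j) ∧
        ∀ j, k < j → j ≤ k + l → Z j ω ≠ y} := by
    filter_upwards [ae_all_iff.2 hZ.mem] with ω hω h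
    refine mem_iUnion.2 ⟨fun j => ⟨Z j ω, hω j⟩, ?_, h.2⟩
    intro j hj
    rcases hj.lt_or_eq with h' | rfl
    · simp [s, h']
    · simpa [s] using h.1
  refine (measure_mono_ae hsub).trans ((measure_iUnion_le _).trans ?_)
  have hs : ∀ h, s h k = x := fun h => by simp [s]
  calc ∑' h, P {ω | (∀ j ≤ k, Z j ω = s h j) ∧ ∀ j, k < j → j ≤ k + l → Z j ω ≠ y}
      ≤ ∑' h, P {ω | ∀ j ≤ k, Z j ω = s h j} * avoidProb p y l x :=
        ENNReal.tsum_le_tsum fun h => by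
          have := hZ.history_avoid_le hS y l k (s h)
          rwa [hs] at this
    _ = P (⋃ h, {ω | ∀ j ≤ k, Z j ω = s h j}) * avoidProb p y l x := by
        rw [ENNReal.tsum_mul_right, measure_iUnion]
        · intro h h' hne
          refine Set.disjoint_left.2 fun ω h1 h2 => hne ?_
          funext j
          have := (h1 j j.2.le).symm.trans (h2 j j.2.le)
          simpa [s, Subtype.ext_iff] using this
        · intro h
          simp only [Set.ofPred_forall]
          exact MeasurableSet.iInter fun j => MeasurableSet.iInter fun _ => hm j _
    _ ≤ 1 * avoidProb p y l x := by gcongr; exact prob_le_one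
    _ = avoidProb p y l x := one_mul _

/-- A bound, uniform in the time, on the distribution of the time since the last visit to the
initial state. -/
theorem IsMarkovChain.age_le [IsProbabilityMeasure P] (hS : S.Countable)
    (hZ : IsMarkovChain P Z S p) (hm : ∀ k (v : E), MeasurableSet {ω | Z k ω = v}) (x : S)
    (a T : ℕ) :
    P {ω | Z 0 ω = x ∧ ∀ j ≤ T, T < j + a → Z j ω ≠ x} ≤ ∑' l, avoidProb p x (l + a) x := by
  classical
  have hsub : {ω | Z 0 ω = x ∧ ∀ j ≤ T, T < j + a → Z j ω ≠ x} ⊆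
      ⋃ l : ℕ, {ω | l + a ≤ T ∧ Z (T - (l + a)) ω = x ∧
        ∀ j, T - (l + a) < j → j ≤ T - (l + a) + (l + a) → Z j ω ≠ x} := by
    rintro ω ⟨h0, h⟩
    -- The last visit to `x` up to time `T`; it exists because the chain starts in `x`. The union is
    -- over its age `T - k = l + a`.
    set k := Nat.findGreatest (fun j => Z j ω = x) T
    have hkx : Z k ω = x := Nat.findGreatest_spec (P := fun j => Z j ω = x) (Nat.zero_le T) h0
    have hkT : k ≤ T := Nat.findGreatest_le T
    have hka : k + a ≤ T := by
      by_contra! hlt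
      exact h k hkT hlt hkx
    refine mem_iUnion.2 ⟨T - k - a, by omega, ?_, ?_⟩
    · rwa [show T - (T - k - a + a) = k by omega]
    · intro j hj hj'
      exact Nat.findGreatest_is_greatest (P := fun j => Z j ω = x) (n := T) (by omega) (by omega)
  refine (measure_mono hsub).trans ((measure_iUnion_le _).trans ?_)
  refine ENNReal.tsum_le_tsum fun l => ?_
  exact (measure_mono fun ω hω => hω.2).trans (hZ.avoid_le hS hm x x (l + a) (T - (l + a)))

end chain

/-! ### New Better than Used in Expectation -/

theorem IsNBUE.mean_nonneg {ν : Measure ℝ} (h : IsNBUE ν) : 0 ≤ ∫ x, x ∂ν :=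
  integral_nonneg_of_ae h.nonneg

theorem IsNBUE.integrable_min {ν : Measure ℝ} [IsProbabilityMeasure ν] (h : IsNBUE ν) (a : ℝ) :
    Integrable (fun x => min x a) ν :=
  h.integrable.inf (integrable_const a)

/-- NBUE times `P(W > a)` reads `E[(W - a)⁺] ≤ μ P(W > a)`; subtract both sides from `μ`. -/
theorem IsNBUE.mean_mul_le_of_pos {ν : Measure ℝ} [IsProbabilityMeasure ν] (h : IsNBUE ν) {a : ℝ}
    (ha : 0 < a) : (∫ x, x ∂ν) * ν.real (Iic a) ≤ ∫ x, min x a ∂ν := by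
  have h1 : ∫ x in Ioi a, (x - a) ∂ν ≤ (∫ x, x ∂ν) * ν.real (Ioi a) := by
    by_cases h0 : ν (Ioi a) = 0
    · rw [Measure.restrict_eq_zero.2 h0, integral_zero_measure]
      exact mul_nonneg h.mean_nonneg measureReal_nonneg
    · have hr := h.residual_le a ha
      have hpos : 0 < ν.real (Ioi a) :=
        ENNReal.toReal_pos h0 (measure_ne_top _ _)
      rw [ProbabilityTheory.cond, integral_smul_measure, ENNReal.toReal_inv, smul_eq_mul] at hr
      change (ν.real (Ioi a))⁻¹ * _ ≤ _ at hr
      rwa [inv_mul_le_iff₀ hpos, mul_comm] at hr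
  have h2 : ∫ x in Ioi a, (x - a) ∂ν = (∫ x, x ∂ν) - ∫ x, min x a ∂ν := by
    rw [← integral_sub h.integrable (h.integrable_min a), ← integral_indicator measurableSet_Ioi]
    refine integral_congr_ae (Filter.Eventually.of_forall fun x => ?_)
    by_cases hx : a < x
    · simp [indicator, hx, hx.le]
    · simp [indicator, hx, not_lt.1 hx]
  have h3 : ν.real (Ioi a) = 1 - ν.real (Iic a) := by
    rw [← compl_Iic, probReal_compl_eq_one_sub measurableSet_Iic]
  rw [h2, h3] at h1
  linarith

theorem IsNBUE.mean_mul_le {ν : Measure ℝ} [IsProbabilityMeasure ν] (h : IsNBUE ν) {a : ℝ}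
    (ha : 0 ≤ a) : (∫ x, x ∂ν) * ν.real (Iic a) ≤ ∫ x, min x a ∂ν := by
  rcases ha.lt_or_eq with ha | rfl
  · exact h.mean_mul_le_of_pos ha
  · have h1 : (∫ x, x ∂ν) * ν.real (Iic 0) ≤ 0 := by
      -- NBUE concerns positive ages only, so `a = 0` is reached through `t ↓ 0`.
      refine le_of_forall_pos_le_add fun t ht => ?_
      calc (∫ x, x ∂ν) * ν.real (Iic 0) ≤ (∫ x, x ∂ν) * ν.real (Iic t) :=
            mul_le_mul_of_nonneg_left (measureReal_mono (Iic_subset_Iic.2 ht.le)) h.mean_nonneg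
        _ ≤ ∫ x, min x t ∂ν := h.mean_mul_le_of_pos ht
        _ ≤ ∫ _, t ∂ν := integral_mono (h.integrable_min t) (integrable_const t)
            fun x => min_le_right x t
        _ = 0 + t := by simp
    refine h1.trans (integral_nonneg_of_ae ?_)
    filter_upwards [h.nonneg] with x hx
    simp [hx]

theorem IsNBUE.ofReal_mean_mul_le {ν : Measure ℝ} [IsProbabilityMeasure ν] (h : IsNBUE ν) {a : ℝ}
    (ha : 0 ≤ a) :
    ENNReal.ofReal (∫ x, x ∂ν) * ν (Iic a) ≤ ∫⁻ x, ENNReal.ofReal (min x a) ∂ν := by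
  rw [← ofReal_integral_eq_lintegral_ofReal (h.integrable_min a), ← ofReal_measureReal,
    ← ENNReal.ofReal_mul h.mean_nonneg]
  · exact ENNReal.ofReal_le_ofReal (h.mean_mul_le ha)
  · filter_upwards [h.nonneg] with x hx
    exact le_min hx ha

/-! ### Resampling a coordinate of a product measure -/

theorem measurePreserving_update_infinitePi {ι : Type*} [DecidableEq ι] {X : ι → Type*}
    [∀ i, MeasurableSpace (X i)] (μ : ∀ i, Measure (X i)) [∀ i, IsProbabilityMeasure (μ i)]
    (i : ι) :
    MeasurePreserving (fun z : (∀ j, X j) × X i => Function.update z.1 i z.2)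
      ((Measure.infinitePi μ).prod (μ i)) (Measure.infinitePi μ) := by
  have hmeas : Measurable fun z : (∀ j, X j) × X i => Function.update z.1 i z.2 :=
    measurable_pi_iff.2 fun j => by
      by_cases hj : j = i
      · subst hj
        simpa using measurable_snd
      · simp only [Function.update_of_ne hj]
        exact (measurable_pi_apply j).comp measurable_fst
  refine ⟨hmeas, Measure.eq_infinitePi _ fun s t ht => ?_⟩
  rw [Measure.map_apply hmeas (MeasurableSet.pi s.countable_toSet fun j _ => ht j)]
  have hpre : (fun z : (∀ j, X j) × X i => Function.update z.1 i z.2) ⁻¹' (Set.pi s t) =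
      (Set.pi (s.erase i : Finset ι) t) ×ˢ (if i ∈ s then t i else univ) := by
    ext z
    simp only [mem_preimage, mem_pi, Finset.mem_coe, mem_prod, Finset.mem_erase]
    constructor
    · intro h
      refine ⟨fun j hj => by simpa [Function.update_of_ne hj.1] using h j hj.2, ?_⟩
      split_ifs with hi
      · simpa using h i hi
      · trivial
    · rintro ⟨h1, h2⟩ j hj
      by_cases hji : j = i
      · subst hji
        simpa [hj] using h2
      · simpa [Function.update_of_ne hji] using h1 j ⟨hji, hj⟩
  rw [hpre, Measure.prod_prod, Measure.infinitePi_pi _ fun j _ => ht j]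
  split_ifs with hi
  · rw [Finset.prod_erase_mul _ _ hi]
  · rw [Finset.erase_eq_of_notMem hi, measure_univ, mul_one]

/-- Replacing one workload by an independent copy preserves the law; the innermost integral then
runs over this single workload, everything else being frozen. -/
theorem lintegral_workloadLaw_resample {n : ℕ} (ν : Fin n → Measure ℝ)
    [∀ i, IsProbabilityMeasure (ν i)] (t : ℕ) (i : Fin n) {f : Workloads n → ℝ≥0∞}
    (hf : Measurable f) :
    ∫⁻ w, f w ∂(workloadLaw ν) = ∫⁻ w, ∫⁻ v, ∫⁻ x,
      f (Function.update w t (Function.update v i x)) ∂(ν i) ∂(Measure.pi ν) ∂(workloadLaw ν) := by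
  have h1 := measurePreserving_update_infinitePi (fun _ : ℕ => Measure.pi ν) t
  have h2 := measurePreserving_update_infinitePi ν i
  rw [Measure.infinitePi_eq_pi] at h2
  unfold workloadLaw
  rw [← h1.lintegral_comp hf,
    lintegral_prod (fun z => f (Function.update z.1 t z.2)) (hf.comp h1.measurable).aemeasurable]
  refine lintegral_congr fun w => ?_
  have hg : Measurable fun v => f (Function.update w t v) :=
    hf.comp (h1.measurable.comp measurable_prodMk_left)
  rw [← h2.lintegral_comp hg, lintegral_prod (fun z => f (Function.update w t
    (Function.update z.1 i z.2))) (hg.comp h2.measurable).aemeasurable]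

/-! ### Core times -/

section coreTime

variable {n m : ℕ} (a : Schedule n m) (i : Fin n)

theorem coreTime_nonneg (u : ℝ) : 0 ≤ coreTime a i u := measureReal_nonneg

theorem coreTime_le_add {r u : ℝ} (h : r ≤ u) : coreTime a i u ≤ coreTime a i r + (u - r) := by
  have hfin : volume ({s : ℝ | 0 ≤ s ∧ s < r ∧ ∃ c, a s c = some i} ∪ Ico r u) ≠ ∞ := by
    refine ((measure_mono (t := Ico 0 r ∪ Ico r u) ?_).trans_lt
      ((measure_union_le _ _).trans_lt ?_)).ne
    · exact union_subset_union_left _ fun s hs => ⟨hs.1, hs.2.1⟩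
    · simp [Real.volume_Ico]
  refine (measureReal_mono ?_ hfin).trans ((measureReal_union_le _ _).trans ?_)
  · rintro s ⟨h0, h1, h2⟩
    rcases lt_or_ge s r with hs | hs
    · exact Or.inl ⟨h0, hs, h2⟩
    · exact Or.inr ⟨hs, h1⟩
  · simp [coreTime, Real.volume_real_Ico_of_le h]

theorem coreTime_mono {r u : ℝ} (h : r ≤ u) : coreTime a i r ≤ coreTime a i u := by
  refine measureReal_mono (fun s hs => ⟨hs.1, hs.2.1.trans_le h, hs.2.2⟩) ?_
  refine ((measure_mono (t := Ico 0 u) fun s hs => ⟨hs.1, hs.2.1⟩).trans_lt ?_).ne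
  simp [Real.volume_Ico]

theorem coreTime_zero : coreTime a i 0 = 0 := by
  have : {r : ℝ | 0 ≤ r ∧ r < 0 ∧ ∃ c, a r c = some i} = ∅ := by
    ext r
    simp only [mem_ofPred_eq, mem_empty_iff_false, iff_false]
    rintro ⟨h0, h1, -⟩
    exact absurd h0 (not_le.2 h1)
  simp [coreTime, this]

theorem coreTime_le {u : ℝ} (hu : 0 ≤ u) : coreTime a i u ≤ u := by
  simpa [coreTime_zero] using coreTime_le_add a i hu

variable {a} in
theorem coreTime_congr {b : Schedule n m} {u : ℝ} (h : ∀ r, 0 ≤ r → r < u → a r = b r) :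
    coreTime a i u = coreTime b i u := by
  unfold coreTime
  congr 1
  ext r
  simp only [mem_ofPred_eq]
  constructor
  · rintro ⟨h0, h1, h2⟩
    exact ⟨h0, h1, h r h0 h1 ▸ h2⟩
  · rintro ⟨h0, h1, h2⟩
    exact ⟨h0, h1, (h r h0 h1).symm ▸ h2⟩

/-- The completion status of a task is right-continuous in time. -/
theorem eventually_completedBy_iff (x r₀ : ℝ) :
    ∀ᶠ r in nhdsWithin r₀ (Ici r₀), (CompletedBy a i x r ↔ CompletedBy a i x r₀) := by
  by_cases h : CompletedBy a i x r₀
  · filter_upwards [self_mem_nhdsWithin] with r hr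
    exact iff_of_true (le_trans h (coreTime_mono a i hr)) h
  · have hlt : r₀ < r₀ + (x - coreTime a i r₀) := by
      have := not_le.1 h
      linarith
    filter_upwards [self_mem_nhdsWithin, mem_nhdsWithin_of_mem_nhds (Iio_mem_nhds hlt)]
      with r hr hr'
    refine iff_of_false (not_le.2 ?_) h
    have := coreTime_le_add a i hr
    simp only [mem_Iio] at hr'
    linarith

end coreTime

/-! ### Consequences of non-clairvoyance -/

namespace Policy

variable {n m : ℕ} {δ : ℝ} (η : Policy n m δ)

/-- Two workload realizations lead to the same schedule in the period `t` up to the time `u`, if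
they agree in the earlier periods, and in the period `t` up to tasks that have not been completed
by the time `u`. -/
theorem schedule_eq (ξ : η.Seed) (w w' : Workloads n) (t : ℕ) (hpast : ∀ s < t, w s = w' s)
    {u : ℝ} (hu : u ≤ δ)
    (hcur : ∀ j, w t j = w' t j ∨ coreTime (η.schedule ξ w t) j u < w t j ∧
      coreTime (η.schedule ξ w t) j u < w' t j)
    {r : ℝ} (hr : 0 ≤ r) (hru : r ≤ u) : η.schedule ξ w t r = η.schedule ξ w' t r := by
  induction t using Nat.strong_induction_on generalizing u r with
  | _ t ih =>
    have hstatus : ∀ s < t, ∀ r j, 0 ≤ r → r ≤ δ →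
        (CompletedBy (η.schedule ξ w s) j (w s j) r ↔
          CompletedBy (η.schedule ξ w' s) j (w' s j) r) := by
      intro s hs r j hr hrδ
      have hw := hpast s hs
      unfold CompletedBy
      rw [hw, coreTime_congr j (b := η.schedule ξ w' s)]
      intro r' hr' hrr'
      exact ih s hs (fun s' hs' => hpast s' (hs'.trans hs)) le_rfl
        (fun j => Or.inl (by rw [hw])) hr' (hrr'.le.trans hrδ)
    -- Continuous induction on time: at the infimum `r₀` of the disagreement times the completion
    -- statuses still agree, since `coreTime` at `r₀` only sees earlier times.
    set D : Set ℝ := {r | 0 ≤ r ∧ r ≤ u ∧ η.schedule ξ w t r ≠ η.schedule ξ w' t r}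
    by_contra hne
    have hrD : r ∈ D := ⟨hr, hru, hne⟩
    have hbdd : BddBelow D := ⟨0, fun s hs => hs.1⟩
    set r₀ := sInf D
    have h0r₀ : 0 ≤ r₀ := le_csInf ⟨r, hrD⟩ fun s hs => hs.1
    have hr₀u : r₀ ≤ u := (csInf_le hbdd hrD).trans hru
    have hbefore : ∀ s, 0 ≤ s → s < r₀ → η.schedule ξ w t s = η.schedule ξ w' t s := by
      intro s hs hsr
      by_contra hsne
      exact absurd (csInf_le hbdd ⟨hs, hsr.le.trans hr₀u, hsne⟩) (not_le.2 hsr)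
    have hstatus₀ : ∀ s j, s ≤ r₀ → (CompletedBy (η.schedule ξ w t) j (w t j) s ↔
        CompletedBy (η.schedule ξ w' t) j (w' t j) s) := by
      intro s j hs
      have hC : coreTime (η.schedule ξ w t) j s = coreTime (η.schedule ξ w' t) j s :=
        coreTime_congr j fun r' hr' hrr' => hbefore r' hr' (hrr'.trans_le hs)
      unfold CompletedBy
      rw [← hC]
      rcases hcur j with h | ⟨h1, h2⟩
      · rw [h]
      · have := coreTime_mono (η.schedule ξ w t) j (hs.trans hr₀u)
        exact iff_of_false (by linarith) (by linarith)
    have hev : ∀ᶠ s in nhdsWithin r₀ (Ici r₀), ∀ j,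
        (CompletedBy (η.schedule ξ w t) j (w t j) s ↔
          CompletedBy (η.schedule ξ w' t) j (w' t j) s) := by
      refine Filter.eventually_all.2 fun j => ?_
      filter_upwards [eventually_completedBy_iff (η.schedule ξ w t) j (w t j) r₀,
        eventually_completedBy_iff (η.schedule ξ w' t) j (w' t j) r₀] with s h1 h2
      rw [h1, h2, hstatus₀ r₀ j le_rfl]
    -- By right-continuity the statuses agree up to some `b > r₀`; non-clairvoyance then excludes
    -- disagreement before `b`.
    obtain ⟨b, hb, hsub⟩ := (mem_nhdsGE_iff_exists_Ico_subset).1 hev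
    have hb' : b ≤ r₀ := by
      refine le_csInf ⟨r, hrD⟩ fun s hs => ?_
      by_contra! hsb
      refine hs.2.2 (η.nonclairvoyant ξ w w' t s hs.1 (hs.2.1.trans hu) ?_)
      rintro s' r' j hr' (⟨h1, h2⟩ | ⟨rfl, h2⟩)
      · exact hstatus s' h1 r' j hr' h2
      · rcases le_or_gt r' r₀ with h | h
        · exact hstatus₀ r' j h
        · exact hsub ⟨h.le, h2.trans_lt hsb⟩ j
    exact absurd hb (not_lt.2 hb')

/-- The core time that a task gets is determined, up to its completion, by what a task
that is never completed would get. -/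
theorem coreTime_update (hδ : 0 ≤ δ) (ξ : η.Seed) (w : Workloads n) (v : Fin n → ℝ) (t : ℕ)
    (i : Fin n) (x : ℝ) :
    let C := fun y => coreTime
      (η.schedule ξ (Function.update w t (Function.update v i y)) t) i δ
    (x ≤ C x ↔ x ≤ C (δ + 1)) ∧ min x (C (δ + 1)) ≤ C x := by
  intro C
  have key : ∀ y z, C y < y → C y < z → C z = C y := by
    intro y z hy hz
    refine (coreTime_congr i fun r hr hrδ => ?_).symm
    refine η.schedule_eq ξ _ _ t (fun s hs => ?_) le_rfl (fun j => ?_) hr hrδ.le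
    · rw [Function.update_of_ne hs.ne, Function.update_of_ne hs.ne]
    · by_cases hj : j = i
      · subst hj
        right
        simpa using ⟨hy, hz⟩
      · left
        simp [hj]
  -- A workload `δ + 1` cannot be completed within a period, so it plays the role of an infinite
  -- one.
  have hC : C (δ + 1) < δ + 1 := (coreTime_le _ i hδ).trans_lt (lt_add_one δ)
  have hCx : C x < δ + 1 := (coreTime_le _ i hδ).trans_lt (lt_add_one δ)
  rcases lt_or_ge (C (δ + 1)) x with h | h
  · have := key _ _ hC h
    rw [this]
    exact ⟨Iff.rfl, min_le_right _ _⟩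
  · have : x ≤ C x := by
      by_contra! hlt
      have := key _ _ hlt hCx
      linarith
    exact ⟨iff_of_true this h, (min_le_left _ _).trans this⟩

theorem measurable_coreTime (t : ℕ) (i : Fin n) (u : ℝ) :
    Measurable fun ω : η.Sample => coreTime (η.schedule ω.1 ω.2 t) i u := by
  have hset : MeasurableSet {z : η.Sample × ℝ | 0 ≤ z.2 ∧ z.2 < u ∧
      ∃ c, η.schedule z.1.1 z.1.2 t z.2 c = some i} := by
    refine (measurableSet_le measurable_const measurable_snd).inter
      ((measurableSet_lt measurable_snd measurable_const).inter ?_)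
    have : {z : η.Sample × ℝ | ∃ c, η.schedule z.1.1 z.1.2 t z.2 c = some i} =
        ⋃ c, MeasurableEquiv.prodAssoc ⁻¹'
          {z : η.Seed × Workloads n × ℝ | η.schedule z.1 z.2.1 t z.2.2 c = some i} := by
      ext z
      simp [MeasurableEquiv.prodAssoc]
    change MeasurableSet {z : η.Sample × ℝ | ∃ c, η.schedule z.1.1 z.1.2 t z.2 c = some i}
    rw [this]
    exact MeasurableSet.iUnion fun c =>
      MeasurableEquiv.prodAssoc.measurable (η.measurable_schedule t c (some i))
  exact (measurable_measure_prodMk_left hset).ennreal_toReal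

theorem measurableSet_completedBy (t : ℕ) (i : Fin n) (u : ℝ) :
    MeasurableSet {ω : η.Sample | CompletedBy (η.schedule ω.1 ω.2 t) i (ω.2 t i) u} :=
  measurableSet_le ((measurable_pi_apply i).comp ((measurable_pi_apply t).comp measurable_snd))
    (η.measurable_coreTime t i u)

/-- The expected core time that a task gets is at least the probability of its completion times
the mean workload. -/
theorem ofReal_mean_mul_completed_le (hδ : 0 ≤ δ) (ν : Fin n → Measure ℝ)
    [∀ i, IsProbabilityMeasure (ν i)] (t : ℕ) (i : Fin n) (hν : IsNBUE (ν i)) :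
    ENNReal.ofReal (∫ x, x ∂(ν i)) *
        η.law ν {ω | CompletedBy (η.schedule ω.1 ω.2 t) i (ω.2 t i) δ} ≤
      ∫⁻ ω, ENNReal.ofReal (coreTime (η.schedule ω.1 ω.2 t) i δ) ∂(η.law ν) := by
  have hprob : IsProbabilityMeasure (workloadLaw ν) := by unfold workloadLaw; infer_instance
  have hset := η.measurableSet_completedBy t i δ
  have hC := (η.measurable_coreTime t i δ).ennreal_ofReal
  have hind : Measurable ({ω : η.Sample | CompletedBy (η.schedule ω.1 ω.2 t) i (ω.2 t i) δ}.indicator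
      (1 : η.Sample → ℝ≥0∞)) := measurable_one.indicator hset
  rw [← lintegral_indicator_one hset, ← lintegral_const_mul _ hind, law,
    lintegral_prod _ (hind.const_mul _).aemeasurable, lintegral_prod _ hC.aemeasurable]
  refine lintegral_mono fun ξ => ?_
  have hind' := (hind.const_mul (ENNReal.ofReal (∫ x, x ∂(ν i)))).comp
    (measurable_prodMk_left (x := ξ))
  have hC' := hC.comp (measurable_prodMk_left (x := ξ))
  refine (lintegral_workloadLaw_resample ν t i hind').trans_le
    (le_of_le_of_eq ?_ (lintegral_workloadLaw_resample ν t i hC').symm)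
  simp only [Function.comp_apply]
  refine lintegral_mono fun w => lintegral_mono fun v => ?_
  have hupd := η.coreTime_update hδ ξ w v t i
  set A := coreTime
    (η.schedule ξ (Function.update w t (Function.update v i (δ + 1))) t) i δ
  -- `A` does not depend on `x`, so completion is the plain event `x ≤ A`.
  have h1 : ∀ x, ({ω : η.Sample | CompletedBy (η.schedule ω.1 ω.2 t) i (ω.2 t i) δ}.indicator
      (1 : η.Sample → ℝ≥0∞)) (ξ, Function.update w t (Function.update v i x)) =
      (Iic A).indicator 1 x := by
    intro x
    have := (hupd x).1
    simp only [indicator, mem_ofPred_eq, CompletedBy, Function.update_self, mem_Iic, Pi.one_apply]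
    simp only [this]
    rfl
  simp only [h1]
  rw [lintegral_const_mul _ (measurable_one.indicator measurableSet_Iic),
    lintegral_indicator_one measurableSet_Iic]
  refine (hν.ofReal_mean_mul_le (coreTime_nonneg _ _ _)).trans (lintegral_mono fun x => ?_)
  exact ENNReal.ofReal_le_ofReal (hupd x).2

/-- The cores provide at most `m` times the length of the time interval. -/
theorem sum_coreTime_le (ξ : η.Seed) (w : Workloads n) (t : ℕ) :
    ∑ i, ENNReal.ofReal (coreTime (η.schedule ξ w t) i δ) ≤ m * ENNReal.ofReal δ := by
  classical
  have hm : ∀ c i, MeasurableSet {r : ℝ | η.schedule ξ w t r c = some i} := fun c i =>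
    (measurable_prodMk_left.comp measurable_prodMk_left :
      Measurable fun r : ℝ => (ξ, w, r)) (η.measurable_schedule t c (some i))
  calc ∑ i, ENNReal.ofReal (coreTime (η.schedule ξ w t) i δ)
      ≤ ∑ i, ∑ c, volume (Ico 0 δ ∩ {r : ℝ | η.schedule ξ w t r c = some i}) := by
        refine Finset.sum_le_sum fun i _ => ?_
        refine ENNReal.ofReal_toReal_le.trans ((measure_mono ?_).trans
          (measure_iUnion_fintype_le _ _))
        rintro r ⟨h0, h1, c, hc⟩
        exact mem_iUnion.2 ⟨c, ⟨h0, h1⟩, hc⟩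
    _ = ∑ c, ∑ i, volume (Ico 0 δ ∩ {r : ℝ | η.schedule ξ w t r c = some i}) :=
        Finset.sum_comm
    _ ≤ ∑ _c : Fin m, ENNReal.ofReal δ := by
        refine Finset.sum_le_sum fun c _ => ?_
        rw [← tsum_fintype (L := .unconditional _), ← measure_iUnion]
        · refine (measure_mono (iUnion_subset fun i => inter_subset_left)).trans ?_
          simp [Real.volume_Ico]
        · intro i j hij
          refine Set.disjoint_left.2 fun r h1 h2 => hij ?_
          have := h1.2.symm.trans h2.2
          simpa using this
        · exact fun i => measurableSet_Ico.inter (hm c i)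
    _ = m * ENNReal.ofReal δ := by simp

end Policy

open Filter Topology

namespace Policy

variable {n m : ℕ} {δ : ℝ} (η : Policy n m δ)

/-! ### Deficits -/

theorem completion_nonneg (t : ℕ) (i : Fin n) (ω : η.Sample) : 0 ≤ η.completion t i ω := by
  unfold completion
  split_ifs <;> norm_num

theorem completion_eq_indicator (t : ℕ) (i : Fin n) :
    η.completion t i = {ω : η.Sample |
      CompletedBy (η.schedule ω.1 ω.2 t) i (ω.2 t i) δ}.indicator 1 := by
  funext ω
  simp [completion, indicator]

theorem measurable_completion (t : ℕ) (i : Fin n) : Measurable (η.completion t i) := by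
  rw [completion_eq_indicator]
  exact measurable_one.indicator (η.measurableSet_completedBy t i δ)

variable (q : Fin n → ℝ) (X₀ : η.Seed → Fin n → ℝ)

theorem measurable_deficit (hX₀ : Measurable X₀) (t : ℕ) : Measurable (η.deficit q X₀ t) := by
  induction t with
  | zero => exact hX₀.comp measurable_fst
  | succ t ih =>
    refine measurable_pi_iff.2 fun i => ?_
    exact ((((measurable_pi_apply i).comp ih).add_const _).sub
      (η.measurable_completion t i)).max measurable_const

theorem deficit_succ_nonneg (t : ℕ) (ω : η.Sample) (i : Fin n) :
    0 ≤ η.deficit q X₀ (t + 1) ω i := le_max_right _ _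

/-- The count starts at `t + 1`, where the deficit is nonnegative; the initial state may be
negative. -/
theorem deficit_add_le (hq : ∀ i, 0 ≤ q i) (t a : ℕ) (ω : η.Sample) (i : Fin n) :
    η.deficit q X₀ (t + 1 + a) ω i ≤ η.deficit q X₀ (t + 1) ω i + a * q i := by
  induction a with
  | zero => simp
  | succ a ih =>
    have h0 := η.deficit_succ_nonneg q X₀ t ω i
    have h1 := η.completion_nonneg (t + 1 + a) i ω
    have h2 : 0 ≤ (a : ℝ) * q i := mul_nonneg a.cast_nonneg (hq i)
    have h3 := hq i
    push_cast
    change max (η.deficit q X₀ (t + 1 + a) ω i + q i - η.completion (t + 1 + a) i ω) 0 ≤ _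
    refine max_le ?_ ?_ <;> linarith

theorem sum_sub_completion_le_deficit (T : ℕ) (ω : η.Sample) (i : Fin n) :
    T * q i - ∑ t ∈ Finset.range T, η.completion (t + 1) i ω ≤ η.deficit q X₀ (T + 1) ω i := by
  induction T with
  | zero => simpa using η.deficit_succ_nonneg q X₀ 0 ω i
  | succ T ih =>
    rw [Finset.sum_range_succ]
    push_cast
    refine le_trans ?_ (le_max_left _ _)
    linarith

/-! ### Sublinear growth of the deficits -/

section growth

variable {η q X₀} {P : Measure η.Sample} [IsProbabilityMeasure P] {S : Set (Fin n → ℝ)}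
  {p : S → PMF S}

/-- For `T` large, a deficit above `ε * T` forces the last visit to `x` to be at least `a` periods
old. The age `a` is fixed first, to make the tail of the series small. -/
theorem tendsto_measure_deficit_of_initial (hq : ∀ i, 0 ≤ q i) (hX₀ : Measurable X₀)
    (hS : S.Countable) (hZ : IsMarkovChain P (fun t => η.deficit q X₀ (t + 1)) S p)
    (hp : PositiveRecurrent p) {ε : ℝ} (hε : 0 < ε) (x : S) :
    Tendsto (fun T : ℕ => P {ω | η.deficit q X₀ (0 + 1) ω = x ∧
      ∃ i, ε * T < η.deficit q X₀ (T + 1) ω i}) atTop (𝓝 0) := by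
  have hm : ∀ k (v : Fin n → ℝ), MeasurableSet {ω | η.deficit q X₀ (k + 1) ω = v} :=
    fun k v => η.measurable_deficit q X₀ hX₀ (k + 1) (measurableSet_singleton v)
  have hsum : ∑' l, avoidProb p x l x ≠ ∞ := by
    rw [tsum_avoidProb p x x (hp x).1]
    exact (hp x).2.ne
  refine ENNReal.tendsto_nhds_zero.2 fun r hr => ?_
  obtain ⟨a, ha⟩ := ((ENNReal.tendsto_nhds_zero.1
    (ENNReal.tendsto_sum_nat_add _ hsum)) r hr).exists
  have hev : ∀ᶠ T : ℕ in atTop, ∀ i, (x : Fin n → ℝ) i + a * q i ≤ ε * T :=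
    eventually_all.2 fun i =>
      (tendsto_natCast_atTop_atTop.const_mul_atTop hε).eventually_ge_atTop _
  filter_upwards [hev] with T hT
  refine (measure_mono ?_).trans ((hZ.age_le hS hm x a T).trans ha)
  rintro ω ⟨h0, i, hi⟩
  refine ⟨h0, fun j hj hja hjx => ?_⟩
  obtain ⟨b, rfl⟩ := Nat.exists_eq_add_of_le hj
  have h1 := η.deficit_add_le q X₀ hq j b ω i
  rw [show j + 1 + b = j + b + 1 by ring, hjx] at h1
  have h2 : (b : ℝ) * q i ≤ a * q i :=
    mul_le_mul_of_nonneg_right (Nat.cast_le.2 (by omega)) (hq i)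
  have := hT i
  linarith

/-- Dominated convergence over the countably many values of `X(1)`, dominated by their
probabilities. -/
theorem tendsto_measure_deficit (hq : ∀ i, 0 ≤ q i) (hX₀ : Measurable X₀)
    (hS : S.Countable) (hZ : IsMarkovChain P (fun t => η.deficit q X₀ (t + 1)) S p)
    (hp : PositiveRecurrent p) {ε : ℝ} (hε : 0 < ε) :
    Tendsto (fun T : ℕ => P.real {ω | ∃ i, ε * T < η.deficit q X₀ (T + 1) ω i})
      atTop (𝓝 0) := by
  have : Countable S := hS.to_subtype
  have hm : ∀ v : Fin n → ℝ, MeasurableSet {ω | η.deficit q X₀ (0 + 1) ω = v} :=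
    fun v => η.measurable_deficit q X₀ hX₀ (0 + 1) (measurableSet_singleton v)
  have hinit : ∑' x : S, P {ω | η.deficit q X₀ (0 + 1) ω = x} ≠ ∞ := by
    rw [← measure_iUnion (f := fun x : S => {ω | η.deficit q X₀ (0 + 1) ω = x}) _ fun x => hm x]
    · exact measure_ne_top _ _
    · intro x y hxy
      exact Set.disjoint_left.2 fun ω h1 h2 => hxy (Subtype.ext (h1.symm.trans h2))
  have hlim : Tendsto (fun T : ℕ => ∑' x : S, P.real {ω | η.deficit q X₀ (0 + 1) ω = x ∧
      ∃ i, ε * T < η.deficit q X₀ (T + 1) ω i}) atTop (𝓝 (∑' _ : S, 0)) := by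
    refine tendsto_tsum_of_dominated_convergence (ENNReal.summable_toReal hinit) (fun x => ?_)
      (Eventually.of_forall fun T x => ?_)
    · exact (ENNReal.tendsto_toReal ENNReal.zero_ne_top).comp
        (tendsto_measure_deficit_of_initial hq hX₀ hS hZ hp hε x)
    · rw [Real.norm_of_nonneg measureReal_nonneg]
      exact measureReal_mono fun ω hω => hω.1
  rw [tsum_zero] at hlim
  refine squeeze_zero (fun _ => measureReal_nonneg) (fun T => ?_) hlim
  have hfin : ∑' x : S, P {ω | η.deficit q X₀ (0 + 1) ω = x ∧
      ∃ i, ε * T < η.deficit q X₀ (T + 1) ω i} ≠ ∞ :=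
    ne_top_of_le_ne_top hinit (ENNReal.tsum_le_tsum fun x => measure_mono fun ω hω => hω.1)
  simp only [Measure.real]
  rw [← ENNReal.tsum_toReal_eq fun x => measure_ne_top _ _]
  refine ENNReal.toReal_mono hfin (le_trans (measure_mono_ae ?_) (measure_iUnion_le _))
  filter_upwards [hZ.mem 0] with ω hω h
  exact mem_iUnion.2 ⟨⟨_, hω⟩, rfl, h⟩

end growth

/-! ### Throughput -/

theorem sum_mean_mul_completed_le (hδ : 0 ≤ δ) (ν : Fin n → Measure ℝ)
    [∀ i, IsProbabilityMeasure (ν i)] [IsProbabilityMeasure (η.law ν)]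
    (hν : ∀ i, IsNBUE (ν i)) (t : ℕ) :
    ∑ i, (∫ x, x ∂(ν i)) * ∫ ω, η.completion t i ω ∂(η.law ν) ≤ m * δ := by
  have hint : ∀ i, ∫ ω, η.completion t i ω ∂(η.law ν) = (η.law ν).real
      {ω | CompletedBy (η.schedule ω.1 ω.2 t) i (ω.2 t i) δ} := by
    intro i
    rw [completion_eq_indicator, integral_indicator_one (η.measurableSet_completedBy t i δ)]
  simp only [hint]
  rw [← ENNReal.ofReal_le_ofReal_iff (by positivity),
    ENNReal.ofReal_sum_of_nonneg fun i _ => mul_nonneg (hν i).mean_nonneg measureReal_nonneg,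
    ENNReal.ofReal_mul (Nat.cast_nonneg m), ENNReal.ofReal_natCast]
  calc ∑ i, ENNReal.ofReal ((∫ x, x ∂(ν i)) * (η.law ν).real
        {ω | CompletedBy (η.schedule ω.1 ω.2 t) i (ω.2 t i) δ})
      ≤ ∑ i, ∫⁻ ω, ENNReal.ofReal (coreTime (η.schedule ω.1 ω.2 t) i δ) ∂(η.law ν) := by
        refine Finset.sum_le_sum fun i _ => ?_
        rw [ENNReal.ofReal_mul (hν i).mean_nonneg, ofReal_measureReal]
        exact η.ofReal_mean_mul_completed_le hδ ν t i (hν i)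
    _ = ∫⁻ ω, ∑ i, ENNReal.ofReal (coreTime (η.schedule ω.1 ω.2 t) i δ) ∂(η.law ν) :=
        (lintegral_finsetSum _ fun i _ => (η.measurable_coreTime t i δ).ennreal_ofReal).symm
    _ ≤ ∫⁻ _, m * ENNReal.ofReal δ ∂(η.law ν) :=
        lintegral_mono fun ω => η.sum_coreTime_le ω.1 ω.2 t
    _ = m * ENNReal.ofReal δ := by simp

variable {q X₀} in
-- Where all deficits are at most `ε * T`, user `i` has at least `T * (q i - ε)` completions;
-- elsewhere the count is bounded below by zero.
theorem mul_measure_le_sum_completion (hX₀ : Measurable X₀) (P : Measure η.Sample)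
    [IsProbabilityMeasure P] (ε : ℝ) (T : ℕ) (i : Fin n) :
    T * (q i - ε) * (1 - P.real {ω | ∃ i, ε * T < η.deficit q X₀ (T + 1) ω i}) ≤
      ∑ t ∈ Finset.range T, ∫ ω, η.completion (t + 1) i ω ∂P := by
  have hint : ∀ t, Integrable (η.completion t i) P := fun t => by
    rw [completion_eq_indicator]
    exact (integrable_const (1 : ℝ)).indicator (η.measurableSet_completedBy t i δ)
  have hB : MeasurableSet {ω | ∃ i, ε * T < η.deficit q X₀ (T + 1) ω i} := by
    rw [Set.ofPred_exists]
    exact MeasurableSet.iUnion fun i => measurableSet_lt measurable_const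
      ((measurable_pi_apply i).comp (η.measurable_deficit q X₀ hX₀ (T + 1)))
  rw [← probReal_compl_eq_one_sub hB, mul_comm, ← smul_eq_mul,
    ← integral_indicator_const _ hB.compl, ← integral_finsetSum _ fun t _ => hint (t + 1)]
  refine integral_mono ((integrable_const _).indicator hB.compl)
    (integrable_finsetSum _ fun t _ => hint (t + 1)) fun ω => ?_
  by_cases hω : ω ∈ {ω | ∃ i, ε * T < η.deficit q X₀ (T + 1) ω i}
  · rw [indicator_of_notMem (notMem_compl_iff.2 hω)]
    exact Finset.sum_nonneg fun t _ => η.completion_nonneg (t + 1) i ω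
  · rw [indicator_of_mem (mem_compl hω)]
    have h1 := η.sum_sub_completion_le_deficit q X₀ T ω i
    have h2 := not_lt.1 (not_exists.1 hω i)
    simp only
    linarith

end Policy

end

end SRT

open Filter Topology in
theorem theorem1 {n m : ℕ} {δ : ℝ} (hδ : 0 < δ) (ν : Fin n → Measure ℝ)
    [∀ i, IsProbabilityMeasure (ν i)] (hν : ∀ i, SRT.IsNBUE (ν i)) :
    SRT.feasibilityRegion m δ ν ⊆ SRT.outerBound m δ ν := by
  rintro q ⟨hq, η, X₀, S, p, hX₀, hS, hZ, -, hp⟩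
  have : IsProbabilityMeasure (SRT.workloadLaw ν) := by unfold SRT.workloadLaw; infer_instance
  have : IsProbabilityMeasure (η.law ν) := by unfold SRT.Policy.law; infer_instance
  have hgood : ∀ ε : ℝ, 0 < ε → Tendsto (fun T : ℕ => 1 - (η.law ν).real
      {ω | ∃ i, ε * T < η.deficit q X₀ (T + 1) ω i}) atTop (𝓝 1) := fun ε hε => by
    simpa using (SRT.Policy.tendsto_measure_deficit hq hX₀ hS hZ hp hε).const_sub 1
  refine ⟨hq, fun i => ?_, ?_⟩
  · refine le_of_forall_pos_le_add fun ε hε => ?_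
    have hlim := (hgood ε hε).const_mul (q i - ε)
    rw [mul_one] at hlim
    suffices q i - ε ≤ 1 by linarith
    refine le_of_tendsto hlim ?_
    filter_upwards [eventually_gt_atTop 0] with T hT
    have h1 := η.mul_measure_le_sum_completion (q := q) hX₀ (η.law ν) ε T i
    have h2 : ∑ t ∈ Finset.range T, ∫ ω, η.completion (t + 1) i ω ∂(η.law ν) ≤ T * 1 := by
      refine (Finset.sum_le_card_nsmul _ _ 1 fun t _ => ?_).trans (by simp)
      rw [SRT.Policy.completion_eq_indicator,
        integral_indicator_one (η.measurableSet_completedBy (t + 1) i δ)]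
      exact measureReal_le_one
    rw [mul_assoc] at h1
    exact le_of_mul_le_mul_left (h1.trans h2) (Nat.cast_pos.2 hT)
  · have hbound : ∀ ε : ℝ, 0 < ε → ∑ i, (q i - ε) * ∫ x, x ∂(ν i) ≤ m * δ := by
      intro ε hε
      have hlim := (hgood ε hε).const_mul (∑ i, (q i - ε) * ∫ x, x ∂(ν i))
      rw [mul_one] at hlim
      refine le_of_tendsto hlim ?_
      filter_upwards [eventually_gt_atTop 0] with T hT
      refine le_of_mul_le_mul_left ?_ (Nat.cast_pos.2 hT : (0 : ℝ) < T)
      calc _ = ∑ i, (∫ x, x ∂(ν i)) * (T * (q i - ε) * (1 - (η.law ν).real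
            {ω | ∃ i, ε * T < η.deficit q X₀ (T + 1) ω i})) := by
            rw [Finset.sum_mul, Finset.mul_sum]
            exact Finset.sum_congr rfl fun i _ => by ring
        _ ≤ ∑ i, (∫ x, x ∂(ν i)) *
              ∑ t ∈ Finset.range T, ∫ ω, η.completion (t + 1) i ω ∂(η.law ν) :=
            Finset.sum_le_sum fun i _ => mul_le_mul_of_nonneg_left
              (η.mul_measure_le_sum_completion hX₀ (η.law ν) ε T i) (hν i).mean_nonneg
        _ = ∑ t ∈ Finset.range T, ∑ i, (∫ x, x ∂(ν i)) *
              ∫ ω, η.completion (t + 1) i ω ∂(η.law ν) := by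
            simp_rw [Finset.mul_sum]
            exact Finset.sum_comm
        _ ≤ ∑ t ∈ Finset.range T, (m * δ : ℝ) :=
            Finset.sum_le_sum fun t _ => η.sum_mean_mul_completed_le hδ.le ν hν (t + 1)
        _ = T * (m * δ) := by simp
    -- The limit `T → ∞` was taken for fixed `ε`; now `ε ↓ 0`.
    have hcont : Tendsto (fun ε : ℝ => ∑ i, (q i - ε) * ∫ x, x ∂(ν i)) (𝓝[>] 0)
        (𝓝 (∑ i, (q i - 0) * ∫ x, x ∂(ν i))) :=
      (Continuous.tendsto (by fun_prop) 0).mono_left nhdsWithin_le_nhds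
    simp only [sub_zero] at hcont
    exact le_of_tendsto hcont (eventually_mem_nhdsWithin.mono fun ε hε => hbound ε hε)
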